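/- Let $M=\{M(t);t\ge 0\}$ be a right-continuous continuous-time Markov chain with finite state space $\{1,\dots,r\}$ and constant transition intensities $q_{i,j}$. A Markov-modulated Poisson process (MMPP) $\{M(t),N_M(t)\}$ with intensity $\lambda_M(t)=\lambda_{M(t)}(t)$, where $\lambda_1,\dots,\lambda_r:[0,\infty)\to[0,\infty)$ are locally integrable functions (constants in the homogeneous case), consists of such a chain $M$ together with a counting process $N_M$ (almost surely integer valued, non-decreasing, right-continuous, $N_M(0)=0$) that, conditionally on the path $\{M(u);u\ge 0\}$, is a Poisson process with intensity $\lambda_M$: for $0\le t_0\le t_1\le\dots\le t_n$ and $k_1,\dots,k_n\in\{0,1,2,\dots\}$, almost surely $$\mathbb P\big[N_M(t_i)-N_M(t_{i-1})=k_i,\ i=1,\dots,n \,\big|\, M(u);u\ge 0\big]=\prod_{i=1}^n e^{-\Lambda_i}\frac{\Lambda_i^{k_i}}{k_i!},\qquad \Lambda_i=\int_{t_{i-1}}^{t_i}\lambda_{M}(u)\,du .$$ Let $\{M(t),N^1_M(t)\}$ and $\{M(t),N^2_M(t)\}$ be two MMPPs on the same probability space with the same underlying Markov chain $M$ and with intensities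 $\lambda^1_M(t)$ and $\lambda^2_M(t)$ respectively, and suppose that the conditional Poisson processes are independent, i.e. the processes $N^1_M$ and $N^2_M$ are conditionally independent given $\{M(u);u\ge 0\}$. Then the combined process $$\{M(t),N^{1,2}_M(t)\}=\{M(t),N^1_M(t)+N^2_M(t)\}$$ is also an MMPP, with the same chain $M$ and with intensity $\lambda_M(t)=\lambda^1_M(t)+\lambda^2_M(t)$. -/

import Mathlib

open MeasureTheory ProbabilityTheory
open scoped NNReal ENNReal ProbabilityTheory

/-- The σ-algebra `σ(X u : u ≥ 0)` generated by a whole process with values in a measurable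
space. -/
abbrev pathSigma {Ω E : Type*} [MeasurableSpace E] (X : ℝ≥0 → Ω → E) : MeasurableSpace Ω :=
  ⨆ u, MeasurableSpace.comap (X u) inferInstance

/-- The history `σ(X u : 0 ≤ u ≤ s)` of a process up to time `s`. -/
abbrev historySigma {Ω E : Type*} [MeasurableSpace E] (X : ℝ≥0 → Ω → E) (s : ℝ≥0) :
    MeasurableSpace Ω :=
  ⨆ u ∈ Set.Iic s, MeasurableSpace.comap (X u) inferInstance

/-- Conditional independence of the σ-algebras `m₁` and `m₂` given `m`, on an arbitrary
probability space (`ProbabilityTheory.CondIndep` is available on standard Borel spaces only, where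
it is characterized by the same formula, see `ProbabilityTheory.condIndep_iff`). -/
def CondIndepGiven {Ω : Type*} [MeasurableSpace Ω] (P : Measure Ω) (m m₁ m₂ : MeasurableSpace Ω) :
    Prop :=
  ∀ A B : Set Ω, MeasurableSet[m₁] A → MeasurableSet[m₂] B →
    P⟦A ∩ B | m⟧ =ᵐ[P] P⟦A | m⟧ * P⟦B | m⟧

/-- `Q` is a transition intensity matrix: `Q i j = q_{i,j} ≥ 0` for `j ≠ i`, and
`Q i i = - ∑_{j ≠ i} q_{i,j}`. -/
def IsIntensityMatrix {r : ℕ} (Q : Matrix (Fin r) (Fin r) ℝ) : Prop :=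
  (∀ i j, i ≠ j → 0 ≤ Q i j) ∧ ∀ i, ∑ j, Q i j = 0

/-- `M` is a continuous-time Markov chain on the state space `Fin r` with constant transition
intensities `Q` (and arbitrary initial law): almost all paths are right-continuous step functions,
and `P[M t = j | M u, u ≤ s] = (exp ((t - s) Q))_{M s, j}` for `s ≤ t`. -/
structure IsMarkovChain {Ω : Type*} [MeasurableSpace Ω] (P : Measure Ω) {r : ℕ}
    (Q : Matrix (Fin r) (Fin r) ℝ) (M : ℝ≥0 → Ω → Fin r) : Prop where
  intensity : IsIntensityMatrix Q
  measurable : ∀ t, Measurable (M t)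
  rightContinuous : ∀ᵐ ω ∂P, ∀ t, ContinuousWithinAt (fun u => M u ω) (Set.Ici t) t
  markov : ∀ s t : ℝ≥0, s ≤ t → ∀ j : Fin r,
    P⟦M t ⁻¹' {j} | historySigma M s⟧ =ᵐ[P]
      fun ω => NormedSpace.exp (((t : ℝ) - (s : ℝ)) • Q) (M s ω) j

/-- The integrated intensity `∫_s^t λ_M(u) du` along the path `u ↦ M u ω`, where
`λ_M(u) = lam (M u) u`. The integral is with respect to Lebesgue measure on the real line
(`u.toNNReal` is `u`, as `0 ≤ s < u`). -/
noncomputable def cumulativeIntensity {Ω : Type*} {r : ℕ} (lam : Fin r → ℝ≥0 → ℝ≥0)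
    (M : ℝ≥0 → Ω → Fin r) (s t : ℝ≥0) (ω : Ω) : ℝ≥0 :=
  (∫⁻ u in Set.Ioc (s : ℝ) (t : ℝ), (lam (M u.toNNReal ω) u.toNNReal : ℝ≥0∞)).toNNReal

/-- `{M(t), N(t)}` is a Markov-modulated Poisson process: `M` is a Markov chain with transition
intensities `Q`, and, conditionally on the path of `M`, the counting process `N` is a Poisson
process with intensity `λ_M(t) = lam (M t) t`, i.e. it starts at `0` and has independent increments
whose laws are Poisson with means `∫_s^t λ_M(u) du`. The homogeneous case is the one in which
`lam i t` does not depend on `t`. -/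
structure IsMMPP {Ω : Type*} [MeasurableSpace Ω] (P : Measure Ω) {r : ℕ}
    (Q : Matrix (Fin r) (Fin r) ℝ) (M : ℝ≥0 → Ω → Fin r) (lam : Fin r → ℝ≥0 → ℝ≥0)
    (N : ℝ≥0 → Ω → ℕ) : Prop where
  chain : IsMarkovChain P Q M
  locallyIntegrable : ∀ (i : Fin r) (T : ℝ≥0),
    IntegrableOn (fun u : ℝ => (lam i u.toNNReal : ℝ)) (Set.Icc 0 (T : ℝ))
  measurable : ∀ t, Measurable (N t)
  zero : ∀ᵐ ω ∂P, N 0 ω = 0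
  monotone : ∀ᵐ ω ∂P, Monotone (fun t => N t ω)
  rightContinuous : ∀ᵐ ω ∂P, ∀ t, ContinuousWithinAt (fun u => N u ω) (Set.Ici t) t
  /-- For `t 0 ≤ t 1 ≤ … ≤ t n`, given the path of `M`, the increments `N (t (i + 1)) - N (t i)`
  are independent Poisson variables with means `∫_{t i}^{t (i + 1)} λ_M(u) du`. -/
  condPoisson : ∀ (n : ℕ) (t : Fin (n + 1) → ℝ≥0), Monotone t → ∀ k : Fin n → ℕ,
    P⟦{ω | ∀ i, N (t i.succ) ω = N (t i.castSucc) ω + k i} | pathSigma M⟧ =ᵐ[P]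
      fun ω => ∏ i,
        (poissonMeasure (cumulativeIntensity lam M (t i.castSucc) (t i.succ) ω)).real {k i}

/-! Given the path of `M`, this is the convolution of independent Poisson laws. Up to a null set,
the event that the increments of `N₁ + N₂` are `k` is a finite disjoint union over the splittings of
each `k i` into two parts (`indicator_incrementEvent_add`). Conditional independence factors each
piece, and the binomial convolution resums the products. The means add (`cumulativeIntensity_add`)
because right-continuous paths of `M` are Borel measurable. -/

/-- The Poisson weights satisfy the binomial convolution identity. -/
theorem poissonMeasure_add_real_singleton (a b : ℝ≥0) (k : ℕ) :
    (poissonMeasure (a + b)).real {k} =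
      ∑ p ∈ Finset.HasAntidiagonal.antidiagonal k,
        (poissonMeasure a).real {p.1} * (poissonMeasure b).real {p.2} := by
  simp only [poissonMeasure_real_singleton, NNReal.coe_add]
  rw [(Commute.all (a : ℝ) b).add_pow', neg_add, Real.exp_add, Finset.mul_sum, Finset.sum_div]
  refine Finset.sum_congr rfl fun p hp => ?_
  rw [← Finset.HasAntidiagonal.mem_antidiagonal.1 hp, nsmul_eq_mul, Nat.cast_add_choose]
  have := Nat.cast_ne_zero (R := ℝ).2 p.1.factorial_ne_zero
  have := Nat.cast_ne_zero (R := ℝ).2 p.2.factorial_ne_zero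
  have := Nat.cast_ne_zero (R := ℝ).2 (p.1 + p.2).factorial_ne_zero
  field_simp

/-- A right-continuous function of a nonnegative real variable is Borel measurable. -/
theorem measurable_of_continuousWithinAt_Ici {E : Type*} [TopologicalSpace E]
    [TopologicalSpace.PseudoMetrizableSpace E] [MeasurableSpace E] [BorelSpace E] {f : ℝ≥0 → E}
    (hf : ∀ t, ContinuousWithinAt f (Set.Ici t) t) : Measurable f := by
  -- The first point of the grid of mesh `1 / (n + 1)` strictly to the right of `u`: `f ∘ a n`
  -- factors through `ℕ`, and `a n u → u` from the right.
  let a : ℕ → ℝ≥0 → ℝ≥0 := fun n u => ((⌊u * (n + 1)⌋₊ : ℝ≥0) + 1) / (n + 1)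
  refine measurable_of_tendsto_metrizable (f := fun n u => f (a n u)) (fun n => ?_)
    (tendsto_pi_nhds.2 fun u => ?_)
  · exact (measurable_from_nat (f := fun m : ℕ => f (((m : ℝ≥0) + 1) / (n + 1)))).comp
      (Nat.measurable_floor.comp (measurable_id.mul_const _))
  · have hle (n : ℕ) : u ≤ a n u := by
      rw [le_div_iff₀ (by positivity)]
      exact (Nat.lt_floor_add_one _).le
    have hge (n : ℕ) : a n u ≤ u + 1 / ((n : ℝ≥0) + 1) := by
      rw [div_le_iff₀ (by positivity), add_mul, div_mul_cancel₀ _ (by positivity)]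
      gcongr
      exact Nat.floor_le (by positivity)
    have hlim : Filter.Tendsto (fun n : ℕ => u + 1 / ((n : ℝ≥0) + 1)) Filter.atTop (nhds u) := by
      simpa using (tendsto_const_nhds (x := u)).add
        (tendsto_one_div_add_atTop_nhds_zero_nat (𝕜 := ℝ≥0))
    exact (hf u).tendsto.comp <| tendsto_nhdsWithin_iff.2
      ⟨tendsto_of_tendsto_of_tendsto_of_le_of_le tendsto_const_nhds hlim hle hge,
        Filter.Eventually.of_forall hle⟩

section CumulativeIntensity

variable {Ω : Type*} {r : ℕ} {lam : Fin r → ℝ≥0 → ℝ≥0} {M : ℝ≥0 → Ω → Fin r} {ω : Ω}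

/-- The state space is finite, so the integrand is a finite sum of the `lam i` cut off to the
measurable sets where the path is in state `i`. -/
theorem aemeasurable_intensity {t : ℝ≥0}
    (hint : ∀ i, IntegrableOn (fun u : ℝ => (lam i u.toNNReal : ℝ)) (Set.Icc 0 (t : ℝ)))
    (hM : Measurable fun u => M u ω) (s : ℝ≥0) :
    AEMeasurable (fun u : ℝ => (lam (M u.toNNReal ω) u.toNNReal : ℝ≥0∞))
      (volume.restrict (Set.Ioc (s : ℝ) t)) := by
  have hsub : Set.Ioc (s : ℝ) t ⊆ Set.Icc 0 (t : ℝ) := fun u hu => ⟨s.2.trans hu.1.le, hu.2⟩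
  have hlam (i : Fin r) : AEMeasurable (fun u : ℝ => (lam i u.toNNReal : ℝ≥0∞))
      (volume.restrict (Set.Ioc (s : ℝ) t)) := by
    simpa using ((hint i).mono_set hsub).aemeasurable.ennreal_ofReal
  have hset (i : Fin r) : MeasurableSet {u : ℝ | M u.toNNReal ω = i} :=
    (hM.comp measurable_real_toNNReal) (measurableSet_singleton i)
  have heq : (fun u : ℝ => (lam (M u.toNNReal ω) u.toNNReal : ℝ≥0∞)) = fun u =>
      ∑ i, {u : ℝ | M u.toNNReal ω = i}.indicator (fun u => (lam i u.toNNReal : ℝ≥0∞)) u := by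
    ext u
    simp [Set.indicator_apply]
  rw [heq]
  exact Finset.aemeasurable_fun_sum _ fun i _ => (hlam i).indicator (hset i)

/-- The sum of the `lam i` over all states dominates the integrand. Finiteness matters because
`ENNReal.toNNReal` sends `∞` to `0` and is not additive there. -/
theorem lintegral_intensity_ne_top {t : ℝ≥0}
    (hint : ∀ i, IntegrableOn (fun u : ℝ => (lam i u.toNNReal : ℝ)) (Set.Icc 0 (t : ℝ)))
    (s : ℝ≥0) :
    ∫⁻ u in Set.Ioc (s : ℝ) t, (lam (M u.toNNReal ω) u.toNNReal : ℝ≥0∞) ≠ ∞ := by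
  have hsub : Set.Ioc (s : ℝ) t ⊆ Set.Icc 0 (t : ℝ) := fun u hu => ⟨s.2.trans hu.1.le, hu.2⟩
  have hsum := integrable_finsetSum Finset.univ fun i _ => (hint i).mono_set hsub
  refine ne_top_of_le_ne_top hsum.lintegral_lt_top.ne (lintegral_mono fun u => ?_)
  rw [← ENNReal.ofReal_coe_nnreal]
  exact ENNReal.ofReal_le_ofReal <| Finset.single_le_sum
    (f := fun i => (lam i u.toNNReal : ℝ)) (fun i _ => NNReal.coe_nonneg _) (Finset.mem_univ _)

theorem cumulativeIntensity_add {lam₁ lam₂ : Fin r → ℝ≥0 → ℝ≥0} {t : ℝ≥0}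
    (h₁ : ∀ i, IntegrableOn (fun u : ℝ => (lam₁ i u.toNNReal : ℝ)) (Set.Icc 0 (t : ℝ)))
    (h₂ : ∀ i, IntegrableOn (fun u : ℝ => (lam₂ i u.toNNReal : ℝ)) (Set.Icc 0 (t : ℝ)))
    (hM : Measurable fun u => M u ω) (s : ℝ≥0) :
    cumulativeIntensity (fun i t => lam₁ i t + lam₂ i t) M s t ω =
      cumulativeIntensity lam₁ M s t ω + cumulativeIntensity lam₂ M s t ω := by
  simp only [cumulativeIntensity, ENNReal.coe_add]
  rw [lintegral_add_left' (aemeasurable_intensity h₁ hM s),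
    ENNReal.toNNReal_add (lintegral_intensity_ne_top h₁ s) (lintegral_intensity_ne_top h₂ s)]

end CumulativeIntensity

/-- The event that the increments of `N` along the times `t` are `k`. -/
def incrementEvent {Ω : Type*} (N : ℝ≥0 → Ω → ℕ) {n : ℕ} (t : Fin (n + 1) → ℝ≥0)
    (k : Fin n → ℕ) : Set Ω :=
  {ω | ∀ i, N (t i.succ) ω = N (t i.castSucc) ω + k i}

theorem measurableSet_incrementEvent {Ω : Type*} {m : MeasurableSpace Ω} {N : ℝ≥0 → Ω → ℕ}
    (hN : ∀ t, Measurable (N t)) {n : ℕ} (t : Fin (n + 1) → ℝ≥0) (k : Fin n → ℕ) :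
    MeasurableSet (incrementEvent N t k) := by
  rw [incrementEvent, Set.ofPred_forall]
  exact MeasurableSet.iInter fun i => measurableSet_eq_fun (hN _) ((hN _).add_const _)

theorem measurable_pathSigma {Ω E : Type*} [MeasurableSpace E] (X : ℝ≥0 → Ω → E) (t : ℝ≥0) :
    Measurable[pathSigma X] (X t) :=
  (comap_measurable (X t)).mono (le_iSup (fun u => MeasurableSpace.comap (X u) _) t) le_rfl

/-- Along monotone paths, the increments of a sum of two processes are `k` exactly when the
increments of the two processes are given by a unique decomposition of `k`. -/
theorem indicator_incrementEvent_add {Ω : Type*} {N₁ N₂ : ℝ≥0 → Ω → ℕ} {ω : Ω}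
    (h₁ : Monotone fun t => N₁ t ω) (h₂ : Monotone fun t => N₂ t ω) {n : ℕ}
    {t : Fin (n + 1) → ℝ≥0} (ht : Monotone t) (k : Fin n → ℕ) :
    (incrementEvent (fun t ω => N₁ t ω + N₂ t ω) t k).indicator (fun _ => (1 : ℝ)) ω =
      ∑ p ∈ Fintype.piFinset fun i => Finset.HasAntidiagonal.antidiagonal (k i),
        (incrementEvent N₁ t (fun i => (p i).1) ∩ incrementEvent N₂ t fun i => (p i).2).indicator
          (fun _ => (1 : ℝ)) ω := by
  have hle₁ (i : Fin n) : N₁ (t i.castSucc) ω ≤ N₁ (t i.succ) ω := h₁ (ht i.castSucc_lt_succ.le)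
  have hle₂ (i : Fin n) : N₂ (t i.castSucc) ω ≤ N₂ (t i.succ) ω := h₂ (ht i.castSucc_lt_succ.le)
  -- The pair of actual increments, the only splitting that can occur at `ω`; by monotonicity the
  -- subtraction in `ℕ` never truncates.
  let q : Fin n → ℕ × ℕ := fun i =>
    (N₁ (t i.succ) ω - N₁ (t i.castSucc) ω, N₂ (t i.succ) ω - N₂ (t i.castSucc) ω)
  have hq (p : Fin n → ℕ × ℕ) : (ω ∈ incrementEvent N₁ t (fun i => (p i).1) ∩
      incrementEvent N₂ t fun i => (p i).2) ↔ q = p := by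
    simp only [incrementEvent, Set.mem_inter_iff, Set.mem_ofPred_eq, ← forall_and, funext_iff,
      Prod.ext_iff, q]
    exact forall_congr' fun i => by have := hle₁ i; have := hle₂ i; omega
  have hk : ω ∈ incrementEvent (fun t ω => N₁ t ω + N₂ t ω) t k ↔
      q ∈ Fintype.piFinset fun i => Finset.HasAntidiagonal.antidiagonal (k i) := by
    simp only [incrementEvent, Set.mem_ofPred_eq, Fintype.mem_piFinset,
      Finset.HasAntidiagonal.mem_antidiagonal, q]
    exact forall_congr' fun i => by have := hle₁ i; have := hle₂ i; omega
  classical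
  simp only [Set.indicator_apply, hq, hk, Finset.sum_ite_eq]

theorem proposition1 {Ω : Type*} [MeasurableSpace Ω] (P : Measure Ω) [IsProbabilityMeasure P]
    {r : ℕ} (Q : Matrix (Fin r) (Fin r) ℝ) (M : ℝ≥0 → Ω → Fin r)
    (lam₁ lam₂ : Fin r → ℝ≥0 → ℝ≥0) (N₁ N₂ : ℝ≥0 → Ω → ℕ)
    (h₁ : IsMMPP P Q M lam₁ N₁) (h₂ : IsMMPP P Q M lam₂ N₂)
    (hind : CondIndepGiven P (pathSigma M) (pathSigma N₁) (pathSigma N₂)) :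
    IsMMPP P Q M (fun i t => lam₁ i t + lam₂ i t) (fun t ω => N₁ t ω + N₂ t ω) where
  chain := h₁.chain
  locallyIntegrable i T := by
    simp only [NNReal.coe_add]
    exact (h₁.locallyIntegrable i T).add (h₂.locallyIntegrable i T)
  measurable t := (h₁.measurable t).add (h₂.measurable t)
  zero := by
    filter_upwards [h₁.zero, h₂.zero] with ω e₁ e₂
    simp [e₁, e₂]
  monotone := by
    filter_upwards [h₁.monotone, h₂.monotone] with ω e₁ e₂
    exact e₁.add e₂
  rightContinuous := by
    filter_upwards [h₁.rightContinuous, h₂.rightContinuous] with ω e₁ e₂ t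
    exact (e₁ t).add (e₂ t)
  condPoisson n t ht k := by
    let A₁ : (Fin n → ℕ × ℕ) → Set Ω := fun p => incrementEvent N₁ t fun i => (p i).1
    let A₂ : (Fin n → ℕ × ℕ) → Set Ω := fun p => incrementEvent N₂ t fun i => (p i).2
    let S := Fintype.piFinset fun i => Finset.HasAntidiagonal.antidiagonal (k i)
    have hsplit : (incrementEvent (fun t ω => N₁ t ω + N₂ t ω) t k).indicator (fun _ => (1 : ℝ))
        =ᵐ[P] ∑ p ∈ S, (A₁ p ∩ A₂ p).indicator fun _ => (1 : ℝ) := by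
      filter_upwards [h₁.monotone, h₂.monotone] with ω e₁ e₂
      rw [Finset.sum_apply]
      exact indicator_incrementEvent_add e₁ e₂ ht k
    have hsum : P⟦incrementEvent (fun t ω => N₁ t ω + N₂ t ω) t k | pathSigma M⟧ =ᵐ[P]
        ∑ p ∈ S, P⟦A₁ p ∩ A₂ p | pathSigma M⟧ :=
      (condExp_congr_ae hsplit).trans <| condExp_finsetSum (fun p _ =>
        (integrable_const (1 : ℝ)).indicator
          ((measurableSet_incrementEvent h₁.measurable t _).inter
            (measurableSet_incrementEvent h₂.measurable t _))) _
    -- There are countably many `p`, so one null set serves them all.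
    have hprod : ∀ᵐ ω ∂P, ∀ p, (P⟦A₁ p ∩ A₂ p | pathSigma M⟧) ω =
        (P⟦A₁ p | pathSigma M⟧) ω * (P⟦A₂ p | pathSigma M⟧) ω :=
      ae_all_iff.2 fun p => hind _ _ (measurableSet_incrementEvent (measurable_pathSigma N₁) t _)
        (measurableSet_incrementEvent (measurable_pathSigma N₂) t _)
    have hpois₁ := ae_all_iff.2 fun p : Fin n → ℕ × ℕ => h₁.condPoisson n t ht fun i => (p i).1
    have hpois₂ := ae_all_iff.2 fun p : Fin n → ℕ × ℕ => h₂.condPoisson n t ht fun i => (p i).2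
    filter_upwards [hsum, hprod, hpois₁, hpois₂, h₁.chain.rightContinuous]
      with ω hω hprodω hω₁ hω₂ hMω
    have hM := measurable_of_continuousWithinAt_Ici hMω
    refine hω.trans ?_
    -- `Finset.prod_univ_sum` turns the product of convolutions into a sum over the same splittings
    -- `S`.
    simp only [cumulativeIntensity_add (h₁.locallyIntegrable · _) (h₂.locallyIntegrable · _) hM,
      poissonMeasure_add_real_singleton, Finset.prod_univ_sum, Finset.sum_apply]
    refine Finset.sum_congr rfl fun p _ => ?_
    rw [hprodω p, Finset.prod_mul_distrib]
    exact congrArg₂ (· * ·) (hω₁ p) (hω₂ p)
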